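/- Let $h\in\mathbb{R}[x,y,z]$ be an irreducible homogeneous polynomial of degree $3$ such that the real projective curve $C=\{h=0\}\subset\mathbb{R}P^2$ is smooth, i.e. there is no point of $\mathbb{R}P^2$ at which both $h$ and its differential $dh$ vanish. Then $h$ is linearly equivalent to a Weierstraß cubic polynomial of nonzero discriminant: there exist $a,b\in\mathbb{R}$ with $a^3-27b^2\neq 0$ and an invertible linear map $A\in\mathrm{GL}(3,\mathbb{R})$ such that $$h\circ A = y^2z-4x^3+axz^2+bz^3 .$$ -/

import Mathlib

open MvPolynomial

/-- The curve `{h = 0}` in the real projective plane. For homogeneous `h` the condition does not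
depend on the representative of the point. -/
def projectiveCurve (h : MvPolynomial (Fin 3) ℝ) : Set (Projectivization ℝ (Fin 3 → ℝ)) :=
  {P | eval P.rep h = 0}

/-- `P` is a singular point of the curve `{h = 0}`: it lies on the curve and the differential of
`h` vanishes at (a representative of) `P`. -/
def IsSingularPoint (h : MvPolynomial (Fin 3) ℝ) (P : Projectivization ℝ (Fin 3 → ℝ)) : Prop :=
  P ∈ projectiveCurve h ∧ ∀ i, eval P.rep (pderiv i h) = 0

/-- The real projective curve `{h = 0}` is smooth: it has no (real) singular point. -/
def HasSmoothProjectiveCurve (h : MvPolynomial (Fin 3) ℝ) : Prop :=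
  ∀ P, ¬ IsSingularPoint h P

/-- Two polynomials on `ℝ³` are linearly equivalent if `g = h ∘ A` for some `A ∈ GL(3, ℝ)`. -/
def LinearlyEquivalent (h g : MvPolynomial (Fin 3) ℝ) : Prop :=
  ∃ A : Matrix.GeneralLinearGroup (Fin 3) ℝ,
    g = bind₁ (A : Matrix (Fin 3) (Fin 3) ℝ).toMvPolynomial h

/-- The Weierstraß cubic `y²z - 4x³ + a x z² + b z³`, where `x, y, z` are the variables
`X 0, X 1, X 2`. -/
noncomputable def weierstrassCubic (a b : ℝ) : MvPolynomial (Fin 3) ℝ :=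
  X 1 ^ 2 * X 2 - 4 * X 0 ^ 3 + C a * X 0 * X 2 ^ 2 + C b * X 2 ^ 3

/-! ### Borsuk–Ulam for odd maps from three-space to the plane -/

section OddMaps

/-! Let T be the polar form of h. Both h and its Hessian determinant, up to a constant det T(v,·,·),
are odd, so Borsuk–Ulam (`exists_ne_zero_of_odd`) gives a common real zero v ≠ 0, with w ≠ 0 such
that T(v,w,·) = 0. Smoothness at v gives u with T(v,v,u) ≠ 0. In the frame (w,v,u) the cubic has few
monomials (`polarForm_combination`), and irreducibility forces T(w,w,w) ≠ 0. Rescaling w and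
adjusting u gives the Weierstraß form (`exists_weierstrass_frame`). If its discriminant vanished,
4x³ - ax - b would have a real multiple root, hence the curve a real singular point. -/

/-- A lift of a nowhere vanishing function on the plane through the exponential. -/
lemma exists_continuous_log (g : C(ℂ, ℂ)) (hg : ∀ z, g z ≠ 0) :
    ∃ F : C(ℂ, ℂ), ∀ z, Complex.exp (F z) = g z := by
  obtain ⟨F, ⟨-, hF⟩, -⟩ := Complex.isCoveringMapOn_exp.existsUnique_continuousMap_lifts g
    (a₀ := 0) (e₀ := Complex.log (g 0)) (Complex.exp_log (hg 0)) (fun z => hg z)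
  exact ⟨F, fun z => congrFun hF z⟩

/-- The Borsuk–Ulam theorem in dimension two: a continuous odd map from `ℝ³` to the plane has a
nontrivial zero. -/
theorem exists_ne_zero_of_odd (f : (Fin 3 → ℝ) → ℂ) (hf : Continuous f)
    (hodd : ∀ v, f (-v) = -f v) : ∃ v, v ≠ 0 ∧ f v = 0 := by
  by_contra! hne
  -- A cone over the unit disc, avoiding 0 and odd on the unit circle. Its domain is all of ℂ, so f
  -- ∘ φ has a global logarithm.
  let φ : ℂ → Fin 3 → ℝ := fun z => ![z.re, z.im, max 0 (1 - ‖z‖)]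
  have hφ : Continuous φ := by
    refine continuous_pi fun i => ?_
    fin_cases i
    · exact Complex.continuous_re
    · exact Complex.continuous_im
    · exact continuous_const.max (continuous_const.sub continuous_norm)
  have hφ0 (z : ℂ) : φ z ≠ 0 := by
    intro h
    have h0 : z.re = 0 := congrFun h 0
    have h1 : z.im = 0 := congrFun h 1
    have h2 : max 0 (1 - ‖z‖) = 0 := congrFun h 2
    have hz : z = 0 := Complex.ext h0 h1
    simp [hz] at h2
  have hneg (z : ℂ) (hz : ‖z‖ = 1) : φ (-z) = -φ z := by
    ext i
    fin_cases i <;> simp [φ, hz]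
  obtain ⟨F, hF⟩ := exists_continuous_log ⟨f ∘ φ, hf.comp hφ⟩ fun z => hne _ (hφ0 z)
  let e : ℝ → ℂ := fun t => Complex.exp (t * Complex.I)
  have he : Continuous e := by fun_prop
  -- Oddness makes exp d equal to -1, but d changes sign along a half-turn, so Im d vanishes
  -- somewhere; there exp d is a positive real.
  let d : ℝ → ℂ := fun t => F (-e t) - F (e t)
  have hd : Continuous d := (F.continuous.comp he.neg).sub (F.continuous.comp he)
  have hexp (t : ℝ) : Complex.exp (d t) = -1 := by
    have hn : ‖e t‖ = 1 := Complex.norm_exp_ofReal_mul_I t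
    have h1 : f (φ (e t)) ≠ 0 := hne _ (hφ0 _)
    simp only [d, Complex.exp_sub, hF, ContinuousMap.coe_mk, Function.comp_apply, hneg _ hn, hodd]
    field_simp
  have hanti : (d Real.pi).im = -(d 0).im := by
    simp [d, e, Complex.exp_pi_mul_I]
  obtain ⟨t, ht⟩ : ∃ t, (d t).im = 0 := by
    have hc : Continuous fun t => (d t).im := Complex.continuous_im.comp hd
    rcases le_total (d 0).im 0 with h | h
    · exact mem_range_of_exists_le_of_exists_ge hc ⟨0, h⟩ ⟨Real.pi, by linarith⟩
    · exact mem_range_of_exists_le_of_exists_ge hc ⟨Real.pi, by linarith⟩ ⟨0, h⟩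
  have h1 := congrArg Complex.re (hexp t)
  rw [Complex.exp_re, ht] at h1
  have := Real.exp_pos (d t).re
  simp at h1
  linarith

end OddMaps

/-! ### The polar form and Euler's identity -/

section Polarization

/-- The symmetric trilinear form `T` attached to the third derivatives of a polynomial `h`; if `h`
is a cubic form then `h(x) = T(x, x, x)`. -/
noncomputable def polarForm (h : MvPolynomial (Fin 3) ℝ) (x y z : Fin 3 → ℝ) : ℝ :=
  ∑ i, ∑ j, ∑ k, x i * y j * z k * (eval 0 (pderiv k (pderiv j (pderiv i h))) / 6)

variable (h : MvPolynomial (Fin 3) ℝ)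

/-- The commutator of two derivations is a derivation, so it suffices to test it on the variables.
-/
lemma pderiv_pderiv_comm (i j : Fin 3) (p : MvPolynomial (Fin 3) ℝ) :
    pderiv i (pderiv j p) = pderiv j (pderiv i p) := by
  have : ⁅(pderiv i : Derivation ℝ (MvPolynomial (Fin 3) ℝ) _),
      (pderiv j : Derivation ℝ (MvPolynomial (Fin 3) ℝ) _)⁆ = 0 := by
    refine MvPolynomial.derivation_ext fun k => ?_
    rw [Derivation.commutator_apply]
    simp only [pderiv_X, Pi.single_apply]
    split_ifs <;> simp
  have h2 := DFunLike.congr_fun this p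
  rw [Derivation.commutator_apply] at h2
  exact sub_eq_zero.mp h2

lemma polarForm_comm (x y z : Fin 3 → ℝ) : polarForm h x y z = polarForm h y x z := by
  unfold polarForm
  rw [Finset.sum_comm]
  refine Finset.sum_congr rfl fun i _ => Finset.sum_congr rfl fun j _ =>
    Finset.sum_congr rfl fun k _ => ?_
  rw [pderiv_pderiv_comm i j, mul_comm (x j)]

lemma polarForm_comm' (x y z : Fin 3 → ℝ) : polarForm h x y z = polarForm h x z y := by
  unfold polarForm
  refine Finset.sum_congr rfl fun i _ => ?_
  rw [Finset.sum_comm]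
  refine Finset.sum_congr rfl fun j _ => Finset.sum_congr rfl fun k _ => ?_
  rw [pderiv_pderiv_comm j k]
  ring

lemma polarForm_add_left (x x' y z : Fin 3 → ℝ) :
    polarForm h (x + x') y z = polarForm h x y z + polarForm h x' y z := by
  simp only [polarForm, Pi.add_apply, add_mul, Finset.sum_add_distrib]

lemma polarForm_smul_left (c : ℝ) (x y z : Fin 3 → ℝ) :
    polarForm h (c • x) y z = c * polarForm h x y z := by
  simp only [polarForm, Pi.smul_apply, smul_eq_mul, Finset.mul_sum, mul_assoc]

lemma polarForm_add_mid (x y y' z : Fin 3 → ℝ) :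
    polarForm h x (y + y') z = polarForm h x y z + polarForm h x y' z := by
  simp only [polarForm_comm h x, polarForm_add_left]

lemma polarForm_smul_mid (c : ℝ) (x y z : Fin 3 → ℝ) :
    polarForm h x (c • y) z = c * polarForm h x y z := by
  simp only [polarForm_comm h x, polarForm_smul_left]

lemma polarForm_add_right (x y z z' : Fin 3 → ℝ) :
    polarForm h x y (z + z') = polarForm h x y z + polarForm h x y z' := by
  simp only [polarForm_comm' h x y, polarForm_add_mid]

lemma polarForm_smul_right (c : ℝ) (x y z : Fin 3 → ℝ) :
    polarForm h x y (c • z) = c * polarForm h x y z := by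
  simp only [polarForm_comm' h x y, polarForm_smul_mid]

lemma polarForm_neg_left (x y z : Fin 3 → ℝ) : polarForm h (-x) y z = -polarForm h x y z := by
  rw [← neg_one_smul ℝ x, polarForm_smul_left]
  ring

lemma polarForm_zero_right (x y : Fin 3 → ℝ) : polarForm h x y 0 = 0 := by
  simp [polarForm]

lemma continuous_polarForm_left (y z : Fin 3 → ℝ) : Continuous fun x => polarForm h x y z := by
  unfold polarForm
  fun_prop

/-- A bilinear slice of the polar form in coordinates. -/
lemma polarForm_eq_sum_single (x y z : Fin 3 → ℝ) :
    polarForm h x y z = ∑ j, ∑ k, y j * z k * polarForm h x (Pi.single j 1) (Pi.single k 1) := by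
  have key (y : Fin 3 → ℝ) :
      y = y 0 • Pi.single 0 1 + y 1 • Pi.single 1 1 + y 2 • Pi.single 2 1 := by
    ext i
    fin_cases i <;> simp
  conv_lhs => rw [key y, key z]
  simp only [polarForm_add_mid, polarForm_smul_mid, polarForm_add_right, polarForm_smul_right,
    Fin.sum_univ_three]
  ring

variable {h}

lemma sum_mul_eval_pderiv {n : ℕ} {p : MvPolynomial (Fin 3) ℝ} (hp : p.IsHomogeneous n)
    (x : Fin 3 → ℝ) : ∑ i, x i * eval x (pderiv i p) = n * eval x p := by
  have := congrArg (eval x) hp.sum_X_mul_pderiv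
  simpa using this

/-- Euler's identity, applied to the first and then the second derivatives, reduces to third
derivatives, which are constant. -/
lemma eval_pderiv_eq_polarForm (hhom : h.IsHomogeneous 3) (x : Fin 3 → ℝ) (i : Fin 3) :
    eval x (pderiv i h) = 3 * polarForm h (Pi.single i 1) x x := by
  have h1 := sum_mul_eval_pderiv (hhom.pderiv (i := i)) x
  have h2 (j : Fin 3) := sum_mul_eval_pderiv ((hhom.pderiv (i := i)).pderiv (i := j)) x
  have h3 (j k : Fin 3) : eval x (pderiv k (pderiv j (pderiv i h))) =
      eval 0 (pderiv k (pderiv j (pderiv i h))) := by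
    have h0 : (pderiv k (pderiv j (pderiv i h))).IsHomogeneous 0 :=
      ((hhom.pderiv (i := i)).pderiv (i := j)).pderiv (i := k)
    rw [← totalDegree_zero_iff_isHomogeneous, totalDegree_eq_zero_iff_eq_C] at h0
    rw [h0, eval_C, eval_C]
  have h4 : polarForm h (Pi.single i 1) x x =
      ∑ j, ∑ k, x j * x k * (eval 0 (pderiv k (pderiv j (pderiv i h))) / 6) := by
    unfold polarForm
    rw [Finset.sum_eq_single i]
    · simp
    · intro b _ hb
      simp [Pi.single_eq_of_ne hb]
    · simp
  rw [h4]
  simp only [h3, Fin.sum_univ_three] at h1 h2 ⊢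
  push_cast at h1 h2
  linear_combination (-1 / 2) * h1 - (1 / 2) * (x 0 * h2 0 + x 1 * h2 1 + x 2 * h2 2)

lemma eval_eq_polarForm (hhom : h.IsHomogeneous 3) (x : Fin 3 → ℝ) :
    eval x h = polarForm h x x x := by
  have h1 := sum_mul_eval_pderiv hhom x
  simp only [eval_pderiv_eq_polarForm hhom] at h1
  have key : polarForm h x x x = ∑ i, x i * polarForm h (Pi.single i 1) x x := by
    have : x = x 0 • Pi.single 0 1 + x 1 • Pi.single 1 1 + x 2 • Pi.single 2 1 := by
      ext i
      fin_cases i <;> simp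
    conv_lhs => enter [2]; rw [this]
    simp only [polarForm_add_left, polarForm_smul_left, Fin.sum_univ_three]
  rw [key]
  simp only [Fin.sum_univ_three] at h1 ⊢
  norm_num at h1
  linear_combination (-1 / 3) * h1

end Polarization

/-! ### Flexes and adapted frames -/

section Cubic

variable {h : MvPolynomial (Fin 3) ℝ}

/-- Smoothness in terms of the polar form: the tangent functional at `p` is nonzero. -/
lemma exists_polarForm_ne_zero (hhom : h.IsHomogeneous 3) (hsmooth : HasSmoothProjectiveCurve h)
    {p : Fin 3 → ℝ} (hp : p ≠ 0) : ∃ u, polarForm h p p u ≠ 0 := by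
  by_contra! hsing
  obtain ⟨c, hc⟩ := Projectivization.exists_smul_eq_mk_rep ℝ p hp
  have hc' : (Projectivization.mk ℝ p hp).rep = (c : ℝ) • p := hc.symm
  refine hsmooth (Projectivization.mk ℝ p hp) ⟨?_, fun i => ?_⟩
  · change eval (Projectivization.mk ℝ p hp).rep h = 0
    rw [hc', eval_eq_polarForm hhom]
    simp [polarForm_smul_left, polarForm_smul_mid, polarForm_smul_right, hsing]
  · rw [hc', eval_pderiv_eq_polarForm hhom, polarForm_comm, polarForm_comm']
    simp [polarForm_smul_left, polarForm_smul_mid, hsing]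

/-- The curve meets its Hessian in a real point. -/
lemma exists_polarForm_degenerate (h : MvPolynomial (Fin 3) ℝ) :
    ∃ v w : Fin 3 → ℝ, v ≠ 0 ∧ w ≠ 0 ∧ polarForm h v v v = 0 ∧ ∀ x, polarForm h v w x = 0 := by
  let M : (Fin 3 → ℝ) → Matrix (Fin 3) (Fin 3) ℝ :=
    fun v => Matrix.of fun j k => polarForm h v (Pi.single j 1) (Pi.single k 1)
  have hM : Continuous M :=
    continuous_matrix fun j k => continuous_polarForm_left h _ _
  have hMneg (v) : M (-v) = -M v := by
    ext j k
    simp [M, polarForm_neg_left]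
  have hc : Continuous fun v => polarForm h v v v := by
    unfold polarForm
    fun_prop
  obtain ⟨v, hv, hfv⟩ := exists_ne_zero_of_odd
    (fun v => (polarForm h v v v : ℂ) + ((M v).det : ℂ) * Complex.I)
    ((Complex.continuous_ofReal.comp hc).add
      ((Complex.continuous_ofReal.comp hM.matrix_det).mul continuous_const)) (by
      intro v
      have h1 : polarForm h (-v) (-v) (-v) = -polarForm h v v v := by
        rw [← neg_one_smul ℝ v, polarForm_smul_left, polarForm_smul_mid, polarForm_smul_right]
        ring
      have h2 : (M (-v)).det = -(M v).det := by
        rw [hMneg, Matrix.det_neg]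
        norm_num
      rw [h1, h2]
      push_cast
      ring)
  have h1 : polarForm h v v v = 0 := by simpa using congrArg Complex.re hfv
  have h2 : (M v).det = 0 := by simpa using congrArg Complex.im hfv
  obtain ⟨w, hw, hMw⟩ := Matrix.exists_mulVec_eq_zero_iff.mpr h2
  refine ⟨v, w, hv, hw, h1, fun x => ?_⟩
  have h3 (j : Fin 3) : ∑ k, M v j k * w k = 0 := congrFun hMw j
  rw [polarForm_comm', polarForm_eq_sum_single]
  have h4 (j : Fin 3) : ∑ k, x j * w k * polarForm h v (Pi.single j 1) (Pi.single k 1) =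
      x j * ∑ k, M v j k * w k := by
    rw [Finset.mul_sum]
    refine Finset.sum_congr rfl fun k _ => ?_
    simp only [M, Matrix.of_apply]
    ring
  simp [h4, h3]

/-- The value of a cubic form in a frame `(w, v, u)` adapted to an inflection point `v`. -/
lemma polarForm_combination {w v u : Fin 3 → ℝ} (hvvv : polarForm h v v v = 0)
    (hvw : ∀ x, polarForm h v w x = 0) (a b c : ℝ) :
    polarForm h (a • w + b • v + c • u) (a • w + b • v + c • u) (a • w + b • v + c • u) =
      a ^ 3 * polarForm h w w w + 3 * a ^ 2 * c * polarForm h w w u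
      + 3 * a * c ^ 2 * polarForm h w u u + 3 * b ^ 2 * c * polarForm h v v u
      + 3 * b * c ^ 2 * polarForm h v u u + c ^ 3 * polarForm h u u u := by
  have r1 (x) : polarForm h w v x = 0 := by rw [polarForm_comm]; exact hvw x
  have r2 (x) : polarForm h v x w = 0 := by rw [polarForm_comm']; exact hvw x
  have r3 (x) : polarForm h w x v = 0 := by rw [polarForm_comm']; exact r1 x
  have r4 (x) : polarForm h x v w = 0 := by rw [polarForm_comm]; exact r2 x
  have r5 (x) : polarForm h x w v = 0 := by rw [polarForm_comm]; exact r3 x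
  have s1 : polarForm h w u w = polarForm h w w u := polarForm_comm' ..
  have s2 : polarForm h u w w = polarForm h w w u := by rw [polarForm_comm, s1]
  have s3 : polarForm h u w u = polarForm h w u u := polarForm_comm ..
  have s4 : polarForm h u u w = polarForm h w u u := by rw [polarForm_comm', s3]
  have s5 : polarForm h v u v = polarForm h v v u := polarForm_comm' ..
  have s6 : polarForm h u v v = polarForm h v v u := by rw [polarForm_comm, s5]
  have s7 : polarForm h u v u = polarForm h v u u := polarForm_comm ..
  have s8 : polarForm h u u v = polarForm h v u u := by rw [polarForm_comm', s7]
  simp only [polarForm_add_left, polarForm_smul_left, polarForm_add_mid, polarForm_smul_mid,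
    polarForm_add_right, polarForm_smul_right, hvvv, hvw, r1, r2, r3, r4, r5, s1, s2, s3, s4, s5,
    s6, s7, s8]
  ring

/-- A frame adapted to an inflection point is linearly independent. -/
lemma exists_generalLinearGroup_of_flex {w v u : Fin 3 → ℝ} (hw : w ≠ 0)
    (hvvv : polarForm h v v v = 0) (hvw : ∀ x, polarForm h v w x = 0)
    (hvvu : polarForm h v v u ≠ 0) :
    ∃ A : Matrix.GeneralLinearGroup (Fin 3) ℝ, ∀ c,
      (A : Matrix (Fin 3) (Fin 3) ℝ).mulVec c = c 0 • w + c 1 • v + c 2 • u := by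
  let A : Matrix (Fin 3) (Fin 3) ℝ := (Matrix.of ![w, v, u]).transpose
  have hA (c) : A.mulVec c = c 0 • w + c 1 • v + c 2 • u := by
    ext i
    simp [A, Matrix.mulVec, dotProduct, Fin.sum_univ_three, mul_comm]
  have hdet : A.det ≠ 0 := by
    intro h0
    obtain ⟨c, hc, hAc⟩ := Matrix.exists_mulVec_eq_zero_iff.mpr h0
    rw [hA] at hAc
    -- T(v,v,·) kills w and v, isolating c 2; next T(v,u,·) kills w and isolates c 1.
    have h2 : c 2 = 0 := by
      have := congrArg (polarForm h v v) hAc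
      rw [polarForm_zero_right] at this
      simp only [polarForm_add_right, polarForm_smul_right, polarForm_comm' h v v w, hvw, hvvv,
        mul_zero, zero_add, mul_eq_zero, hvvu, or_false] at this
      exact this
    have h1 : c 1 = 0 := by
      have := congrArg (polarForm h v u) hAc
      rw [polarForm_zero_right] at this
      simp only [polarForm_add_right, polarForm_smul_right, polarForm_comm' h v u w, hvw, h2,
        polarForm_comm' h v u v, mul_zero, zero_add, zero_mul, add_zero, mul_eq_zero, hvvu,
        or_false] at this
      exact this
    have h0 : c 0 = 0 := by
      rw [h1, h2] at hAc
      simpa [hw] using hAc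
    exact hc (by ext i; fin_cases i <;> assumption)
  exact ⟨Matrix.GeneralLinearGroup.mkOfDetNeZero A hdet, hA⟩

lemma eval_bind₁_toMvPolynomial (A : Matrix (Fin 3) (Fin 3) ℝ) (p : MvPolynomial (Fin 3) ℝ)
    (c : Fin 3 → ℝ) : eval c (bind₁ A.toMvPolynomial p) = eval (A.mulVec c) p := by
  rw [← aeval_eq_eval, ← aeval_eq_eval, aeval_bind₁]
  congr 2
  funext i
  rw [aeval_eq_eval]
  exact Matrix.toMvPolynomial_eval_eq_apply A i c

/-- Pulling back by the inverse of A factors h itself. The factors still vanish at the origin, so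
neither is a unit. -/
lemma not_irreducible_of_bind₁_eq_mul {A : Matrix.GeneralLinearGroup (Fin 3) ℝ}
    {p q : MvPolynomial (Fin 3) ℝ}
    (hpq : bind₁ (A : Matrix (Fin 3) (Fin 3) ℝ).toMvPolynomial h = p * q)
    (hp : eval 0 p = 0) (hq : eval 0 q = 0) : ¬ Irreducible h := by
  intro hirr
  let B : Matrix (Fin 3) (Fin 3) ℝ := ((A⁻¹ : Matrix.GeneralLinearGroup (Fin 3) ℝ) : _)
  have hB : (A : Matrix (Fin 3) (Fin 3) ℝ) * B = 1 := by
    rw [← Units.val_mul, mul_inv_cancel, Units.val_one]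
  have hh : h = bind₁ B.toMvPolynomial p * bind₁ B.toMvPolynomial q := by
    rw [← map_mul, ← hpq]
    refine MvPolynomial.funext fun c => ?_
    rw [eval_bind₁_toMvPolynomial, eval_bind₁_toMvPolynomial, Matrix.mulVec_mulVec, hB,
      Matrix.one_mulVec]
  have hnu (r : MvPolynomial (Fin 3) ℝ) (hr : eval 0 r = 0) :
      ¬ IsUnit (bind₁ B.toMvPolynomial r) := by
    intro hu
    have := hu.map (eval (0 : Fin 3 → ℝ))
    rw [eval_bind₁_toMvPolynomial, Matrix.mulVec_zero, hr] at this
    exact not_isUnit_zero this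
  exact (hirr.isUnit_or_isUnit hh).elim (hnu p hp) (hnu q hq)

/-- An irreducible cubic form does not vanish on an inflectional tangent line. -/
lemma polarForm_self_ne_zero_of_flex (hhom : h.IsHomogeneous 3) (hirr : Irreducible h)
    {w v u : Fin 3 → ℝ} (hw : w ≠ 0) (hvvv : polarForm h v v v = 0)
    (hvw : ∀ x, polarForm h v w x = 0) (hvvu : polarForm h v v u ≠ 0) :
    polarForm h w w w ≠ 0 := by
  intro hwww
  obtain ⟨A, hA⟩ := exists_generalLinearGroup_of_flex hw hvvv hvw hvvu
  -- `X 2` cuts out the tangent line through v and w; without the cube of `X 0`, it divides every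
  -- remaining monomial.
  refine not_irreducible_of_bind₁_eq_mul (A := A) (p := X 2)
    (q := C (3 * polarForm h w w u) * X 0 ^ 2 + C (3 * polarForm h w u u) * X 0 * X 2
      + C (3 * polarForm h v v u) * X 1 ^ 2 + C (3 * polarForm h v u u) * X 1 * X 2
      + C (polarForm h u u u) * X 2 ^ 2) ?_ (by simp) (by simp) hirr
  refine MvPolynomial.funext fun c => ?_
  rw [eval_bind₁_toMvPolynomial, hA, eval_eq_polarForm hhom, polarForm_combination hvvv hvw, hwww]
  simp only [map_add, map_mul, map_pow, eval_C, eval_X]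
  ring

lemma exists_cube_eq (r : ℝ) : ∃ s : ℝ, s ^ 3 = r :=
  mem_range_of_exists_le_of_exists_ge (continuous_pow 3)
    ⟨-(1 + |r|), by
      nlinarith [neg_abs_le r, abs_nonneg r, sq_nonneg |r|, pow_nonneg (abs_nonneg r) 3]⟩
    ⟨1 + |r|, by
      nlinarith [le_abs_self r, abs_nonneg r, sq_nonneg |r|, pow_nonneg (abs_nonneg r) 3]⟩

/-- The frame in which a smooth irreducible cubic form is in Weierstraß form. -/
lemma exists_weierstrass_frame (hhom : h.IsHomogeneous 3) (hirr : Irreducible h)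
    (hsmooth : HasSmoothProjectiveCurve h) :
    ∃ w v u : Fin 3 → ℝ, w ≠ 0 ∧ polarForm h v v v = 0 ∧ (∀ x, polarForm h v w x = 0) ∧
      polarForm h w w w = -4 ∧ polarForm h w w u = 0 ∧ polarForm h v v u = 1 / 3 ∧
      polarForm h v u u = 0 := by
  obtain ⟨v, w, hv, hw, hvvv, hvw⟩ := exists_polarForm_degenerate h
  obtain ⟨u, hvvu⟩ := exists_polarForm_ne_zero hhom hsmooth hv
  have hwww := polarForm_self_ne_zero_of_flex hhom hirr hw hvvv hvw hvvu
  obtain ⟨s, hs⟩ := exists_cube_eq (-4 / polarForm h w w w)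
  have hs0 : s ≠ 0 := by
    rintro rfl
    have : (-4 : ℝ) / polarForm h w w w ≠ 0 := div_ne_zero (by norm_num) hwww
    exact this (by rw [← hs]; norm_num)
  have hvxw (x) : polarForm h v x w = 0 := by rw [polarForm_comm']; exact hvw x
  have hwwv : polarForm h w w v = 0 := by rw [polarForm_comm', polarForm_comm]; exact hvw w
  have hvuv : polarForm h v u v = polarForm h v v u := polarForm_comm' ..
  -- The v-shift kills T(v,u,u) and the w-shift kills T(w,w,u); they do not interfere, since
  -- T(v,w,·) = 0. The outer factor makes the coefficient of y²z, which is 3T(v,v,u), equal to 1.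
  refine ⟨s • w, v, (1 / (3 * polarForm h v v u)) • (u
      + (-polarForm h v u u / (2 * polarForm h v v u)) • v
      + (-polarForm h w w u / polarForm h w w w) • w), smul_ne_zero hs0 hw, hvvv, ?_, ?_, ?_, ?_, ?_⟩
  · intro x
    rw [polarForm_smul_mid, hvw, mul_zero]
  · rw [polarForm_smul_left, polarForm_smul_mid, polarForm_smul_right]
    have : s ^ 3 * polarForm h w w w = -4 := by rw [hs]; field_simp
    linear_combination this
  · simp only [polarForm_smul_left, polarForm_smul_mid, polarForm_smul_right, polarForm_add_right,
      hwwv]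
    field_simp
    ring
  · simp only [polarForm_smul_right, polarForm_add_right, hvvv, hvxw]
    field_simp
    ring
  · simp only [polarForm_smul_mid, polarForm_smul_right, polarForm_add_mid, polarForm_add_right,
      hvvv, hvxw, hvw, hvuv]
    field_simp
    ring

end Cubic

/-! ### The normal form and its discriminant -/

theorem proposition2p3 (h : MvPolynomial (Fin 3) ℝ) (hhom : h.IsHomogeneous 3)
    (hirr : Irreducible h) (hsmooth : HasSmoothProjectiveCurve h) :
    ∃ a b : ℝ, a ^ 3 - 27 * b ^ 2 ≠ 0 ∧ LinearlyEquivalent h (weierstrassCubic a b) := by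
  obtain ⟨w, v, u, hw, hvvv, hvw, hwww, hwwu, hvvu, hvuu⟩ :=
    exists_weierstrass_frame hhom hirr hsmooth
  obtain ⟨A, hA⟩ := exists_generalLinearGroup_of_flex hw hvvv hvw (by rw [hvvu]; norm_num)
  refine ⟨3 * polarForm h w u u, polarForm h u u u, ?_, A, ?_⟩
  · intro hdisc
    obtain ⟨a, ha⟩ : ∃ a, a = 3 * polarForm h w u u := ⟨_, rfl⟩
    obtain ⟨b, hb⟩ : ∃ b, b = polarForm h u u u := ⟨_, rfl⟩
    rw [← ha, ← hb] at hdisc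
    -- A multiple root of 4x³ - ax - b. The two equations are the vanishing of the x- and
    -- z-derivatives of the Weierstraß cubic at (x : 0 : 1).
    obtain ⟨x, hx1, hx2⟩ : ∃ x : ℝ, 12 * x ^ 2 = a ∧ 2 * a * x + 3 * b = 0 := by
      by_cases ha0 : a = 0
      · have hb0 : b = 0 := by simpa [ha0] using hdisc
        exact ⟨0, by simp [ha0], by simp [hb0]⟩
      · refine ⟨-3 * b / (2 * a), ?_, ?_⟩
        · field_simp
          linear_combination -4 * hdisc
        · field_simp
          ring
    have hwuw : polarForm h w u w = 0 := by rw [polarForm_comm', hwwu]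
    have huww : polarForm h u w w = 0 := by rw [polarForm_comm, hwuw]
    have huwu : polarForm h u w u = polarForm h w u u := polarForm_comm ..
    have huuw : polarForm h u u w = polarForm h w u u := by rw [polarForm_comm', huwu]
    have hwxv (y) : polarForm h w y v = 0 := by rw [polarForm_comm', polarForm_comm]; exact hvw y
    have huwv : polarForm h u w v = 0 := by rw [polarForm_comm, hwxv]
    have huuv : polarForm h u u v = 0 := by rw [polarForm_comm', polarForm_comm, hvuu]
    have hvvw : polarForm h v v w = 0 := by rw [polarForm_comm', hvw]
    -- The point (x : 0 : 1) in the frame (w,v,u); below, T(p,p,·) vanishes there, against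
    -- smoothness.
    have hp : x • w + u ≠ 0 := by
      intro h0
      have := congrArg (polarForm h v v) h0
      rw [polarForm_add_right, polarForm_smul_right, hvvw, hvvu, polarForm_zero_right] at this
      norm_num at this
    obtain ⟨y, hy⟩ := exists_polarForm_ne_zero hhom hsmooth hp
    obtain ⟨c, rfl⟩ : ∃ c : Fin 3 → ℝ, c 0 • w + c 1 • v + c 2 • u = y := by
      refine ⟨((A⁻¹ : Matrix.GeneralLinearGroup (Fin 3) ℝ) : Matrix (Fin 3) (Fin 3) ℝ).mulVec y, ?_⟩
      rw [← hA, Matrix.mulVec_mulVec, ← Units.val_mul, mul_inv_cancel, Units.val_one,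
        Matrix.one_mulVec]
    apply hy
    simp only [polarForm_add_left, polarForm_smul_left, polarForm_add_mid, polarForm_smul_mid,
      polarForm_add_right, polarForm_smul_right, hwww, hwuw, huww, hwwu, huuw, huwu, hwxv, huwv,
      huuv, ← hb]
    linear_combination (-c 0 / 3) * hx1 - (c 0 / 3) * ha + (c 2 / 3) * hx2 - (2 * x * c 2 / 3) * ha
  · refine MvPolynomial.funext fun c => ?_
    rw [eval_bind₁_toMvPolynomial, hA, eval_eq_polarForm hhom, polarForm_combination hvvv hvw,
      hwww, hwwu, hvvu, hvuu]
    simp only [weierstrassCubic, map_add, map_sub, map_mul, map_pow, eval_C, eval_X, map_ofNat]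
    ring
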